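/- For $n\ge 0$ and a permutation $\pi$ of $\{1,\dots,n\}$ let $$\operatorname{altdes}(\pi)=\bigl|\{\,1\le i\le n-1: i \text{ even},\ \pi(i)<\pi(i+1)\,\}\cup\{\,1\le i\le n-1: i\text{ odd},\ \pi(i)>\pi(i+1)\,\}\bigr|,$$ and let $A^{*}_n(q)=\sum_{\pi\in\mathcal S_n}q^{\operatorname{altdes}(\pi)}$ be the alternating Eulerian polynomials. For a sequence $f=\{f_i(q)\}_{i\ge0}$ of polynomials with real coefficients let $\mathcal L f$ be the sequence $\{f_{i-1}(q)f_{i+1}(q)-f_i(q)^2\}_{i\ge1}$ (reindexed from $0$ before $\mathcal L$ is applied again), and call $f$ $k$-$q$-log-convex if for every $0\le m\le k$ all terms of $\mathcal L^m f$ have only nonnegative coefficients. Then: (i) As formal power series in $x$ over $\mathbb R[q]$, $$\sum_{n=0}^{\infty}A^{*}_{n+1}(q)\,x^n=\cfrac{1}{1-g_0x-\cfrac{h_1x^2}{1-g_1x-\cfrac{h_2x^2}{1-g_2x-\cdots}}},$$ where $g_i=(i+1)(q+1)$ for $i\ge0$ and $h_i=(q^2+1)\,i(i+1)/2$ for $i\ge1$;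 that is, the finite continued fractions ending in the denominator $1-g_nx$ converge coefficientwise (in $x$) to the left-hand side as $n\to\infty$. (ii) The sequence $\{A^{*}_{n+1}(q)\}_{n\ge0}$ is $2$-$q$-log-convex. -/

import Mathlib

open Polynomial

/-- The number of alternating descents of a permutation `π` of `{1, …, n}`: the number of positions
`i` with `1 ≤ i ≤ n - 1` such that either `i` is even and `π(i) < π(i + 1)`, or `i` is odd and
`π(i) > π(i + 1)`. The position `i` is written `j + 1` with `j : Fin n` (so that the entries
`π(i)`, `π(i + 1)` are the values at the 0-based places `j`, `j + 1`). -/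
def altDes {n : ℕ} (π : Equiv.Perm (Fin n)) : ℕ :=
  Finset.card (Finset.univ.filter fun j : Fin n =>
    ∃ hj : (j : ℕ) + 1 < n,
      (Even ((j : ℕ) + 1) ∧ π j < π ⟨(j : ℕ) + 1, hj⟩) ∨
        (Odd ((j : ℕ) + 1) ∧ π ⟨(j : ℕ) + 1, hj⟩ < π j))

/-- The alternating Eulerian polynomial `A*_n(q) = ∑_{π ∈ S_n} q ^ altdes(π)`, as a polynomial
with real coefficients in the variable `q = X`. -/
noncomputable def altEulerian (n : ℕ) : ℝ[X] :=
  ∑ π : Equiv.Perm (Fin n), (X : ℝ[X]) ^ altDes π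

section ContinuedFraction

variable {R : Type*} [CommRing R]

/-- The finite Jacobi continued fraction of depth `n` starting at level `i`,
`1/(1 - g_i x - h_{i+1} x²/(1 - g_{i+1} x - ⋯ - h_{i+n} x²/(1 - g_{i+n} x)))`,
as a formal power series in `x`. Every denominator has constant coefficient `1`
(see `constantCoeff_jacobiDenom` below), so `PowerSeries.invOfUnit _ 1` is its true inverse. -/
noncomputable def jacobiConvergent (g h : ℕ → R) : ℕ → ℕ → PowerSeries R
  | 0, i => PowerSeries.invOfUnit (1 - PowerSeries.C (g i) * PowerSeries.X) 1
  | n + 1, i => PowerSeries.invOfUnit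
      (1 - PowerSeries.C (g i) * PowerSeries.X
        - PowerSeries.C (h (i + 1)) * PowerSeries.X ^ 2 * jacobiConvergent g h n (i + 1)) 1

theorem constantCoeff_jacobiDenom (a b : R) (φ : PowerSeries R) :
    PowerSeries.constantCoeff
      (1 - PowerSeries.C a * PowerSeries.X - PowerSeries.C b * PowerSeries.X ^ 2 * φ) = 1 := by
  simp

theorem jacobiConvergent_zero_mul (g h : ℕ → R) (i : ℕ) :
    (1 - PowerSeries.C (g i) * PowerSeries.X) * jacobiConvergent g h 0 i = 1 := by
  rw [jacobiConvergent]
  exact PowerSeries.mul_invOfUnit _ _ (by simp)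

theorem jacobiConvergent_succ_mul (g h : ℕ → R) (n i : ℕ) :
    (1 - PowerSeries.C (g i) * PowerSeries.X
      - PowerSeries.C (h (i + 1)) * PowerSeries.X ^ 2 * jacobiConvergent g h n (i + 1))
      * jacobiConvergent g h (n + 1) i = 1 := by
  rw [jacobiConvergent]
  exact PowerSeries.mul_invOfUnit _ _ (by simp)

/-- `F` is the infinite Jacobi continued fraction
`1/(1 - g_0 x - h_1 x²/(1 - g_1 x - h_2 x²/(1 - g_2 x - ⋯)))`: the finite continued fractions
converge to `F` as formal power series in `x`, i.e. each coefficient is eventually that of `F`. -/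
def HasJacobiFraction (F : PowerSeries R) (g h : ℕ → R) : Prop :=
  ∀ m : ℕ, ∀ᶠ n in Filter.atTop,
    PowerSeries.coeff m (jacobiConvergent g h n 0) = PowerSeries.coeff m F

end ContinuedFraction

/-- The operator `L` sending `(f_i)_{i ≥ 0}` to `(f_{i-1} f_{i+1} - f_i²)_{i ≥ 1}`; the result is
reindexed to start at `0`. -/
noncomputable def logConvexOp (f : ℕ → ℝ[X]) : ℕ → ℝ[X] :=
  fun i => f i * f (i + 2) - f (i + 1) ^ 2

/-- `k`-`q`-log-convexity: for every `m ≤ k`, all coefficients of all members of the sequence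
`L^m (f)` are nonnegative. -/
def IsQLogConvexOrder (k : ℕ) (f : ℕ → ℝ[X]) : Prop :=
  ∀ m ≤ k, ∀ i j : ℕ, 0 ≤ ((logConvexOp^[m] f) i).coeff j

/-! Splitting a permutation at its largest entry expresses `altEulerian` as a binomial convolution.
Complementation exchanges ascents and descents, so counting may start with either kind; the two
resulting recurrences add up to a symmetric one (`two_mul_altEulerian_succ`). It says that the
exponential generating series F, without constant term, satisfies F' = 1 + (q+1)F + (q²+1)/2 · F².

By this Riccati equation, (F^k F')' is a combination of F^(k-1) F', F^k F' and F^(k+1) F'. Hence the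
numbers n! [x^n] F^k F' form an array generated by a tridiagonal matrix, whose column 0 is the
sequence A*_{n+1}.

Both claims follow from the array. The relations between neighbouring columns unroll into the Jacobi
fraction (`hasJacobiFraction`). The terms of L f and L² f are, up to nonnegative factors, minors of
order 2 and 3 on consecutive rows (`hankel_det2`, `hankel_det3`). By Cauchy–Binet and induction on
the row these have nonnegative coefficients as soon as the contiguous principal minors of order 2
and 3 of the tridiagonal matrix do. -/

/-! ### Arrangements of a finite set as lists. -/

section Arrangements

variable {γ δ : Type*}

/-- The finite set of arrangements of a finite set as a list. -/
def arrangements (s : Finset γ) : Finset (List γ) :=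
  ⟨Multiset.lists s.val, Multiset.lists_nodup_finset s⟩

theorem mem_arrangements {s : Finset γ} {l : List γ} :
    l ∈ arrangements s ↔ s.val = (l : Multiset γ) :=
  Multiset.mem_lists_iff _ _

theorem mem_of_mem_arrangements {s : Finset γ} {l : List γ} (h : l ∈ arrangements s) {x : γ} :
    x ∈ l ↔ x ∈ s := by
  rw [← Finset.mem_val, mem_arrangements.1 h, Multiset.mem_coe]

theorem length_of_mem_arrangements {s : Finset γ} {l : List γ} (h : l ∈ arrangements s) :
    l.length = s.card := by
  rw [Finset.card_def, mem_arrangements.1 h, Multiset.coe_card]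

theorem sum_arrangements_map {A : Type*} [AddCommMonoid A] (f : γ ↪ δ) (s : Finset γ)
    (φ : List δ → A) :
    ∑ l ∈ arrangements (s.map f), φ l = ∑ l ∈ arrangements s, φ (l.map f) := by
  symm
  refine Finset.sum_bij (fun l _ => l.map f) ?_ ?_ ?_ fun _ _ => rfl
  · intro l hl
    rw [mem_arrangements] at hl ⊢
    rw [Finset.map_val, hl, Multiset.map_coe]
  · intro l _ l' _ h
    exact List.map_injective_iff.2 f.injective h
  · intro l hl
    have hr : l ∈ Set.range (List.map f) := by
      rw [Set.range_list_map]
      intro x hx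
      obtain ⟨y, -, rfl⟩ := Finset.mem_map.1 ((mem_of_mem_arrangements hl).1 hx)
      exact ⟨y, rfl⟩
    obtain ⟨l', rfl⟩ := hr
    refine ⟨l', ?_, rfl⟩
    rw [mem_arrangements] at hl ⊢
    rw [Finset.map_val, ← Multiset.map_coe] at hl
    exact Multiset.map_injective f.injective hl

end Arrangements

/-! ### Alternating descents of lists and splitting at the maximum. -/

section Lists

variable {γ : Type*} [LinearOrder γ] {δ : Type*} [LinearOrder δ]

/-- The number of alternating descents of a list: places whose entry is an ascent or a descent,
the type that is counted alternating from place to place. It is ascents at the first place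
if `b` is `true`, and descents if `b` is `false`. -/
def listAltDes : Bool → List γ → ℕ
  | _, [] => 0
  | _, [_] => 0
  | b, x :: y :: l => (if (b = true ∧ x < y) ∨ (b = false ∧ y < x) then 1 else 0)
      + listAltDes (!b) (y :: l)

theorem listAltDes_map_strictMono {f : γ → δ} (hf : StrictMono f) (b : Bool) (l : List γ) :
    listAltDes b (l.map f) = listAltDes b l := by
  induction l generalizing b with
  | nil => rfl
  | cons x l ih =>
    cases l with
    | nil => rfl
    | cons y l =>
      have := ih (!b)
      simp only [List.map_cons] at this
      simp only [List.map_cons, listAltDes, this, hf.lt_iff_lt]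

theorem listAltDes_map_strictAnti {f : γ → δ} (hf : StrictAnti f) (b : Bool) (l : List γ) :
    listAltDes b (l.map f) = listAltDes (!b) l := by
  induction l generalizing b with
  | nil => rfl
  | cons x l ih =>
    cases l with
    | nil => rfl
    | cons y l =>
      have := ih (!b)
      simp only [List.map_cons] at this
      simp only [List.map_cons, listAltDes, this, hf.lt_iff_gt]
      cases b <;> simp

theorem listAltDes_cons_of_forall_lt {b : Bool} {m : γ} {l : List γ} (h : ∀ x ∈ l, x < m) :
    listAltDes b (m :: l) = (if b = false ∧ l ≠ [] then 1 else 0) + listAltDes (!b) l := by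
  cases l with
  | nil => simp [listAltDes]
  | cons y l =>
    have hy : y < m := h y (by simp)
    have hy' : ¬ m < y := hy.not_gt
    simp [listAltDes, hy, hy']

/-- A maximum is entered by an ascent and left by a descent. These sit at consecutive places, where
opposite kinds are counted, so both count or neither does, according to the parity of its position.
-/
theorem listAltDes_append_cons {b : Bool} {m : γ} {l₁ l₂ : List γ} (h₁ : ∀ x ∈ l₁, x < m)
    (h₂ : ∀ x ∈ l₂, x < m) :
    listAltDes b (l₁ ++ m :: l₂) = listAltDes b l₁
      + (if b = l₁.length.bodd then (if l₁ ≠ [] then 1 else 0) + (if l₂ ≠ [] then 1 else 0) else 0)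
      + listAltDes (b == l₁.length.bodd) l₂ := by
  induction l₁ generalizing b with
  | nil =>
    rw [List.nil_append, listAltDes_cons_of_forall_lt h₂]
    cases b <;> simp [listAltDes]
  | cons x l₁ ih =>
    cases l₁ with
    | nil =>
      have hx : x < m := h₁ x (by simp)
      have hx' : ¬ m < x := hx.not_gt
      rw [List.cons_append, List.nil_append, listAltDes.eq_def b (x :: m :: l₂)]
      simp only [listAltDes_cons_of_forall_lt h₂]
      cases b <;> by_cases hl : l₂ = [] <;> simp [listAltDes, hx, hx', hl]
      omega
    | cons y l₁ =>
      have := @ih (!b) (fun z hz => h₁ z (by simp [hz]))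
      rw [List.cons_append] at this
      rw [List.cons_append, List.cons_append, listAltDes, this, listAltDes]
      have hbodd : (x :: y :: l₁).length.bodd = !(y :: l₁).length.bodd := by simp
      rw [hbodd]
      cases b <;> cases (y :: l₁).length.bodd <;> simp <;> ring

theorem listAltDes_ofFn {n : ℕ} (b : Bool) (f : Fin n → γ) :
    listAltDes b (List.ofFn f) = Finset.card (Finset.univ.filter fun j : Fin n =>
      ∃ hj : (j : ℕ) + 1 < n, (Nat.bodd j ≠ b ∧ f j < f ⟨(j : ℕ) + 1, hj⟩) ∨
        (Nat.bodd j = b ∧ f ⟨(j : ℕ) + 1, hj⟩ < f j)) := by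
  induction n generalizing b with
  | zero => simp [listAltDes]
  | succ n ih =>
    cases n with
    | zero =>
      rw [eq_comm, List.ofFn_succ, List.ofFn_zero, listAltDes, Finset.card_eq_zero,
        Finset.filter_eq_empty_iff]
      rintro j - ⟨hj, -⟩
      omega
    | succ n =>
      have := ih (!b) (fun i => f i.succ)
      rw [List.ofFn_succ] at this
      rw [List.ofFn_succ, List.ofFn_succ, listAltDes, this, Finset.card_filter, Finset.card_filter,
        Fin.sum_univ_succ (n := n + 1)]
      congr 1
      · refine if_congr ?_ rfl rfl
        simp only [Fin.val_zero, Nat.bodd_zero]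
        cases b <;> simp
      · refine Finset.sum_congr rfl fun j _ => if_congr ?_ rfl rfl
        refine ⟨fun ⟨hj, h⟩ => ⟨by simp; omega, ?_⟩, fun ⟨hj, h⟩ => ⟨by simp at hj; omega, ?_⟩⟩ <;>
        · simp only [Fin.val_succ, Nat.bodd_succ] at h ⊢
          cases b <;> cases hb : Nat.bodd (j : ℕ) <;> simp_all [Fin.succ]

/-- An arrangement is cut at the unique occurrence of `m`; `T` is the set of entries before it. -/
theorem sum_arrangements_insert {A : Type*} [AddCommMonoid A] {m : γ} {t : Finset γ} (hm : m ∉ t)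
    (φ : List γ → A) :
    ∑ l ∈ arrangements (insert m t), φ l
      = ∑ T ∈ t.powerset, ∑ l₁ ∈ arrangements T, ∑ l₂ ∈ arrangements (t \ T),
          φ (l₁ ++ m :: l₂) := by
  simp_rw [Finset.sum_sigma']
  symm
  refine Finset.sum_bij (fun p _ => p.2.1 ++ m :: p.2.2) ?_ ?_ ?_ fun _ _ => rfl
  · rintro ⟨T, l₁, l₂⟩ h
    simp only [Finset.mem_sigma, Finset.mem_powerset, mem_arrangements] at h ⊢
    obtain ⟨hT, h₁, h₂⟩ := h
    rw [Finset.insert_val_of_notMem hm, ← Multiset.coe_add, ← Multiset.cons_coe, ← h₁, ← h₂,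
      Multiset.add_cons, Finset.sdiff_val, add_tsub_cancel_of_le (Finset.val_le_iff.2 hT)]
  · rintro ⟨T, l₁, l₂⟩ h ⟨T', l₁', l₂'⟩ h' heq
    simp only [Finset.mem_sigma, Finset.mem_powerset] at h h' heq
    have n₁ : m ∉ l₁' := fun hx => hm (h'.1 ((mem_of_mem_arrangements h'.2.1).1 hx))
    have n₂ : m ∉ l₂ := fun hx => hm (Finset.sdiff_subset ((mem_of_mem_arrangements h.2.2).1 hx))
    have n₃ : m ∉ l₁ := fun hx => hm (h.1 ((mem_of_mem_arrangements h.2.1).1 hx))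
    obtain ⟨rfl, -, rfl⟩ := (List.append_cons_inj_of_notMem n₃ n₂).1 heq
    have : T = T' := Finset.val_injective <|
      (mem_arrangements.1 h.2.1).trans (mem_arrangements.1 h'.2.1).symm
    subst this
    rfl
  · intro l hl
    have hml : m ∈ l := (mem_of_mem_arrangements hl).2 (Finset.mem_insert_self _ _)
    obtain ⟨l₁, l₂, rfl⟩ := List.append_of_mem hml
    rw [mem_arrangements, Finset.insert_val_of_notMem hm, ← Multiset.coe_add, ← Multiset.cons_coe,
      Multiset.add_cons, Multiset.cons_inj_right] at hl
    have hle : (l₁ : Multiset γ) ≤ t.val := hl ▸ Multiset.le_add_right _ _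
    refine ⟨⟨⟨l₁, Multiset.nodup_of_le hle t.nodup⟩, l₁, l₂⟩, ?_, rfl⟩
    simp only [Finset.mem_sigma, Finset.mem_powerset, mem_arrangements, true_and]
    refine ⟨Finset.val_le_iff.1 hle, ?_⟩
    rw [Finset.sdiff_val]
    exact (congrArg (· - (l₁ : Multiset γ)) hl).trans (add_tsub_cancel_left _ _)

/-- The generating polynomial of alternating descents of the arrangements of a finite set. -/
noncomputable def altSum (b : Bool) (s : Finset γ) : ℝ[X] :=
  ∑ l ∈ arrangements s, (X : ℝ[X]) ^ listAltDes b l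

/-- The exponent contributed by a largest entry with `k` entries before it and `r` after it. -/
def peakExp (b : Bool) (k r : ℕ) : ℕ :=
  if b = k.bodd then (if k ≠ 0 then 1 else 0) + (if r ≠ 0 then 1 else 0) else 0

theorem altSum_insert (b : Bool) {m : γ} {t : Finset γ} (hm : ∀ x ∈ t, x < m) :
    altSum b (insert m t) = ∑ T ∈ t.powerset,
      X ^ peakExp b T.card (t \ T).card * altSum b T * altSum (b == T.card.bodd) (t \ T) := by
  rw [altSum, sum_arrangements_insert fun h => lt_irrefl _ (hm m h)]
  refine Finset.sum_congr rfl fun T hT => ?_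
  rw [altSum, altSum, mul_assoc, Finset.sum_mul_sum, Finset.mul_sum]
  refine Finset.sum_congr rfl fun l₁ h₁ => ?_
  rw [Finset.mul_sum]
  refine Finset.sum_congr rfl fun l₂ h₂ => ?_
  rw [listAltDes_append_cons
    (fun x hx => hm x (Finset.mem_powerset.1 hT ((mem_of_mem_arrangements h₁).1 hx)))
    (fun x hx => hm x (Finset.sdiff_subset ((mem_of_mem_arrangements h₂).1 hx))),
    peakExp, ← length_of_mem_arrangements h₁, ← length_of_mem_arrangements h₂]
  simp only [ne_eq, List.length_eq_zero_iff]
  ring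

theorem altSum_univ_fin_card (b : Bool) (s : Finset γ) :
    altSum b s = altSum b (Finset.univ : Finset (Fin s.card)) := by
  conv_lhs => rw [← Finset.map_orderEmbOfFin_univ s rfl, altSum, sum_arrangements_map]
  refine Finset.sum_congr rfl fun l _ => ?_
  exact congrArg _ (listAltDes_map_strictMono (s.orderEmbOfFin rfl).strictMono b l)

/-- Complementing the values turns every ascent into a descent, so the kind counted first does not
affect the distribution. -/
theorem altSum_univ_fin_not (b : Bool) (n : ℕ) :
    altSum (!b) (Finset.univ : Finset (Fin n)) = altSum b (Finset.univ : Finset (Fin n)) := by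
  conv_rhs => rw [← Finset.map_univ_equiv (Fin.revPerm (n := n)), altSum, sum_arrangements_map]
  refine Finset.sum_congr rfl fun l _ => ?_
  exact congrArg _ (listAltDes_map_strictAnti Fin.rev_strictAnti b l).symm

end Lists

/-! ### Recurrences for the alternating Eulerian polynomials. -/

/-- Position 1 is odd and counts descents, hence the flag `false`. -/
theorem altEulerian_eq_altSum (n : ℕ) :
    altEulerian n = altSum false (Finset.univ : Finset (Fin n)) := by
  refine Finset.sum_bij (fun π _ => List.ofFn π) ?_ ?_ ?_ ?_
  · intro π _
    rw [mem_arrangements]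
    have h : (Finset.univ : Finset (Fin n)).val = ((Finset.univ : Finset (Fin n)).map
      π.toEmbedding).val := by rw [Finset.map_univ_equiv]
    rw [h, Finset.map_val, Fin.univ_val_map]
    rfl
  · intro π _ σ _ h
    exact Equiv.coe_fn_injective (List.ofFn_injective h)
  · intro l hl
    have hlen : l.length = n := by simpa using length_of_mem_arrangements hl
    have hnd : l.Nodup := by
      rw [← Multiset.coe_nodup, ← mem_arrangements.1 hl]
      exact Finset.nodup _
    have hinj : Function.Injective fun i : Fin n => l.get (i.cast hlen.symm) :=
      (List.nodup_iff_injective_get.1 hnd).comp (Fin.cast_injective _)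
    exact ⟨Equiv.ofBijective _ (Finite.injective_iff_bijective.1 hinj), Finset.mem_univ _,
      List.ext_get (by simp [hlen]) (by simp)⟩
  · intro π _
    rw [listAltDes_ofFn, altDes]
    congr 2
    refine Finset.filter_congr fun j _ => exists_congr fun hj => ?_
    rw [← Nat.not_even_iff_odd, Nat.even_add_one, not_not, Nat.even_iff, Nat.mod_two_of_bodd]
    cases Nat.bodd (j : ℕ) <;> simp

theorem altSum_eq_altEulerian {γ : Type*} [LinearOrder γ] (b : Bool) (s : Finset γ) :
    altSum b s = altEulerian s.card := by
  rw [altSum_univ_fin_card, altEulerian_eq_altSum]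
  cases b
  · rfl
  · exact altSum_univ_fin_not false _

/-- The left side is independent of `b` but the exponents on the right are not, so these are two
different recurrences. -/
theorem altEulerian_succ (b : Bool) (n : ℕ) :
    altEulerian (n + 1) = ∑ k ∈ Finset.range (n + 1),
      n.choose k • (X ^ peakExp b k (n - k) * altEulerian k * altEulerian (n - k)) := by
  have h := altSum_insert b (m := n) (t := Finset.range n) (by simp)
  rw [altSum_eq_altEulerian, Finset.card_insert_of_notMem (by simp), Finset.card_range] at h
  have h' := Finset.sum_powerset_apply_card (x := Finset.range n)
    fun k => X ^ peakExp b k (n - k) * altEulerian k * altEulerian (n - k)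
  rw [Finset.card_range] at h'
  rw [h, ← h']
  refine Finset.sum_congr rfl fun T hT => ?_
  rw [altSum_eq_altEulerian, altSum_eq_altEulerian,
    Finset.card_sdiff_of_subset (Finset.mem_powerset.1 hT), Finset.card_range]

theorem altEulerian_zero : altEulerian 0 = 1 := by
  simp [altEulerian, altDes]

theorem altEulerian_one : altEulerian 1 = 1 := by
  rw [altEulerian_succ false]
  simp [peakExp, altEulerian_zero]

/-- The two recurrences of `altEulerian_succ` added up. -/
theorem two_mul_altEulerian_succ (n : ℕ) :
    2 * altEulerian (n + 2) = 2 * ((1 + X) * altEulerian (n + 1))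
      + (1 + X ^ 2) * ∑ k ∈ Finset.range n, (n + 1).choose (k + 1) •
        (altEulerian (k + 1) * altEulerian (n - k)) := by
  have hf := altEulerian_succ false (n + 1)
  have ht := altEulerian_succ true (n + 1)
  -- A maximum at either end gives exponent 0 for one flag and 1 for the other, hence the factor 1 +
  -- X. In the interior the exponents are 0 and 2, hence 1 + X² in `hs`.
  rw [Finset.sum_range_succ, Finset.sum_range_succ'] at hf ht
  have hs : ∀ k ∈ Finset.range n,
      (n + 1).choose (k + 1) • (X ^ peakExp false (k + 1) (n + 1 - (k + 1))
          * altEulerian (k + 1) * altEulerian (n + 1 - (k + 1)))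
        + (n + 1).choose (k + 1) • (X ^ peakExp true (k + 1) (n + 1 - (k + 1))
          * altEulerian (k + 1) * altEulerian (n + 1 - (k + 1)))
      = (1 + X ^ 2) * ((n + 1).choose (k + 1) • (altEulerian (k + 1) * altEulerian (n - k))) := by
    intro k hk
    have hk' := Finset.mem_range.1 hk
    have h₁ : n + 1 - (k + 1) = n - k := by omega
    have h₂ : n - k ≠ 0 := by omega
    rw [h₁]
    simp only [peakExp, nsmul_eq_mul]
    cases (k + 1).bodd <;> simp [h₂] <;> ring
  rw [Finset.mul_sum, ← Finset.sum_congr rfl hs, Finset.sum_add_distrib, two_mul]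
  refine (congrArg₂ (· + ·) hf ht).trans ?_
  simp [peakExp, altEulerian_zero]
  cases n.bodd <;> simp <;> ring

/-! ### Minors of order 2 and 3 of tridiagonal arrays. -/

section Minors

variable {R : Type*} [CommRing R]

/-- The determinant of the columns `u`, `v` restricted to the rows `n, n + 1`. -/
def det2 (u v : ℕ → R) (n : ℕ) : R := u n * v (n + 1) - u (n + 1) * v n

/-- The determinant of the columns `u`, `v`, `w` restricted to the rows `n, n + 1, n + 2`. -/
def det3 (u v w : ℕ → R) (n : ℕ) : R :=
  u n * det2 v w (n + 1) - v n * det2 u w (n + 1) + w n * det2 u v (n + 1)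

theorem det2_self (u : ℕ → R) (n : ℕ) : det2 u u n = 0 := by simp only [det2]; ring

theorem det3_self_left (u w : ℕ → R) (n : ℕ) : det3 u u w n = 0 := by
  simp only [det3, det2]; ring

theorem det3_self_right (u w : ℕ → R) (n : ℕ) : det3 u w w n = 0 := by
  simp only [det3, det2]; ring

variable (S : Subsemiring R)

/-- The combination `a u₀ + b u₁ + c u₂` of three columns. -/
def comb3 (a b c : R) (u₀ u₁ u₂ : ℕ → R) : ℕ → R := fun n => a * u₀ n + b * u₁ n + c * u₂ n

variable {S} {a b c a' b' c' a'' b'' c'' : R} {u v w u₀ u₁ u₂ u₃ u₄ : ℕ → R} {n : ℕ}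

theorem det2_comb3_left (ha : a ∈ S) (hb : b ∈ S) (hc : c ∈ S) (h₀ : det2 u₀ v n ∈ S)
    (h₁ : det2 u₁ v n ∈ S) (h₂ : det2 u₂ v n ∈ S) : det2 (comb3 a b c u₀ u₁ u₂) v n ∈ S := by
  have : det2 (comb3 a b c u₀ u₁ u₂) v n
      = a * det2 u₀ v n + b * det2 u₁ v n + c * det2 u₂ v n := by
    simp only [det2, comb3]; ring
  rw [this]
  exact add_mem (add_mem (mul_mem ha h₀) (mul_mem hb h₁)) (mul_mem hc h₂)

theorem det2_comb3_right (ha : a ∈ S) (hb : b ∈ S) (hc : c ∈ S) (h₀ : det2 u u₀ n ∈ S)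
    (h₁ : det2 u u₁ n ∈ S) (h₂ : det2 u u₂ n ∈ S) : det2 u (comb3 a b c u₀ u₁ u₂) n ∈ S := by
  have : det2 u (comb3 a b c u₀ u₁ u₂) n
      = a * det2 u u₀ n + b * det2 u u₁ n + c * det2 u u₂ n := by
    simp only [det2, comb3]; ring
  rw [this]
  exact add_mem (add_mem (mul_mem ha h₀) (mul_mem hb h₁)) (mul_mem hc h₂)

/-- Cauchy–Binet for overlapping combinations: only the pair `u₁`, `u₂` arises in both orders, and
its coefficient is a 2 × 2 minor of the tridiagonal matrix. -/
theorem det2_comb3_comb3 (ha : a ∈ S) (hb : b ∈ S) (hc : c ∈ S) (ha' : a' ∈ S) (hb' : b' ∈ S)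
    (hc' : c' ∈ S) (hbb : b * b' - c * a' ∈ S)
    (h01 : det2 u₀ u₁ n ∈ S) (h02 : det2 u₀ u₂ n ∈ S) (h03 : det2 u₀ u₃ n ∈ S)
    (h12 : det2 u₁ u₂ n ∈ S) (h13 : det2 u₁ u₃ n ∈ S) (h23 : det2 u₂ u₃ n ∈ S) :
    det2 (comb3 a b c u₀ u₁ u₂) (comb3 a' b' c' u₁ u₂ u₃) n ∈ S := by
  have : det2 (comb3 a b c u₀ u₁ u₂) (comb3 a' b' c' u₁ u₂ u₃) n
      = a * a' * det2 u₀ u₁ n + a * b' * det2 u₀ u₂ n + a * c' * det2 u₀ u₃ n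
        + (b * b' - c * a') * det2 u₁ u₂ n + b * c' * det2 u₁ u₃ n
        + c * c' * det2 u₂ u₃ n := by
    simp only [det2, comb3]; ring
  rw [this]
  exact add_mem (add_mem (add_mem (add_mem (add_mem (mul_mem (mul_mem ha ha') h01)
    (mul_mem (mul_mem ha hb') h02)) (mul_mem (mul_mem ha hc') h03)) (mul_mem hbb h12))
    (mul_mem (mul_mem hb hc') h13)) (mul_mem (mul_mem hc hc') h23)

theorem det3_comb3_left (ha : a ∈ S) (hb : b ∈ S) (hc : c ∈ S) (h₀ : det3 u₀ v w n ∈ S)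
    (h₁ : det3 u₁ v w n ∈ S) (h₂ : det3 u₂ v w n ∈ S) :
    det3 (comb3 a b c u₀ u₁ u₂) v w n ∈ S := by
  have : det3 (comb3 a b c u₀ u₁ u₂) v w n
      = a * det3 u₀ v w n + b * det3 u₁ v w n + c * det3 u₂ v w n := by
    simp only [det3, det2, comb3]; ring
  rw [this]
  exact add_mem (add_mem (mul_mem ha h₀) (mul_mem hb h₁)) (mul_mem hc h₂)

theorem det3_comb3_mid (ha : a ∈ S) (hb : b ∈ S) (hc : c ∈ S) (h₀ : det3 u u₀ w n ∈ S)
    (h₁ : det3 u u₁ w n ∈ S) (h₂ : det3 u u₂ w n ∈ S) :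
    det3 u (comb3 a b c u₀ u₁ u₂) w n ∈ S := by
  have : det3 u (comb3 a b c u₀ u₁ u₂) w n
      = a * det3 u u₀ w n + b * det3 u u₁ w n + c * det3 u u₂ w n := by
    simp only [det3, det2, comb3]; ring
  rw [this]
  exact add_mem (add_mem (mul_mem ha h₀) (mul_mem hb h₁)) (mul_mem hc h₂)

theorem det3_comb3_right (ha : a ∈ S) (hb : b ∈ S) (hc : c ∈ S) (h₀ : det3 u v u₀ n ∈ S)
    (h₁ : det3 u v u₁ n ∈ S) (h₂ : det3 u v u₂ n ∈ S) :
    det3 u v (comb3 a b c u₀ u₁ u₂) n ∈ S := by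
  have : det3 u v (comb3 a b c u₀ u₁ u₂) n
      = a * det3 u v u₀ n + b * det3 u v u₁ n + c * det3 u v u₂ n := by
    simp only [det3, det2, comb3]; ring
  rw [this]
  exact add_mem (add_mem (mul_mem ha h₀) (mul_mem hb h₁)) (mul_mem hc h₂)

theorem det3_comb3_comb3_left (ha : a ∈ S) (hb : b ∈ S) (hc : c ∈ S) (ha' : a' ∈ S)
    (hb' : b' ∈ S) (hc' : c' ∈ S) (hbb : b * b' - c * a' ∈ S)
    (h01 : det3 u₀ u₁ w n ∈ S) (h02 : det3 u₀ u₂ w n ∈ S) (h03 : det3 u₀ u₃ w n ∈ S)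
    (h12 : det3 u₁ u₂ w n ∈ S) (h13 : det3 u₁ u₃ w n ∈ S) (h23 : det3 u₂ u₃ w n ∈ S) :
    det3 (comb3 a b c u₀ u₁ u₂) (comb3 a' b' c' u₁ u₂ u₃) w n ∈ S := by
  have : det3 (comb3 a b c u₀ u₁ u₂) (comb3 a' b' c' u₁ u₂ u₃) w n
      = a * a' * det3 u₀ u₁ w n + a * b' * det3 u₀ u₂ w n + a * c' * det3 u₀ u₃ w n
        + (b * b' - c * a') * det3 u₁ u₂ w n + b * c' * det3 u₁ u₃ w n
        + c * c' * det3 u₂ u₃ w n := by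
    simp only [det3, det2, comb3]; ring
  rw [this]
  exact add_mem (add_mem (add_mem (add_mem (add_mem (mul_mem (mul_mem ha ha') h01)
    (mul_mem (mul_mem ha hb') h02)) (mul_mem (mul_mem ha hc') h03)) (mul_mem hbb h12))
    (mul_mem (mul_mem hb hc') h13)) (mul_mem (mul_mem hc hc') h23)

theorem det3_comb3_comb3_right (ha : a ∈ S) (hb : b ∈ S) (hc : c ∈ S) (ha' : a' ∈ S)
    (hb' : b' ∈ S) (hc' : c' ∈ S) (hbb : b * b' - c * a' ∈ S)
    (h01 : det3 u u₀ u₁ n ∈ S) (h02 : det3 u u₀ u₂ n ∈ S) (h03 : det3 u u₀ u₃ n ∈ S)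
    (h12 : det3 u u₁ u₂ n ∈ S) (h13 : det3 u u₁ u₃ n ∈ S) (h23 : det3 u u₂ u₃ n ∈ S) :
    det3 u (comb3 a b c u₀ u₁ u₂) (comb3 a' b' c' u₁ u₂ u₃) n ∈ S := by
  have : det3 u (comb3 a b c u₀ u₁ u₂) (comb3 a' b' c' u₁ u₂ u₃) n
      = a * a' * det3 u u₀ u₁ n + a * b' * det3 u u₀ u₂ n + a * c' * det3 u u₀ u₃ n
        + (b * b' - c * a') * det3 u u₁ u₂ n + b * c' * det3 u u₁ u₃ n
        + c * c' * det3 u u₂ u₃ n := by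
    simp only [det3, det2, comb3]; ring
  rw [this]
  exact add_mem (add_mem (add_mem (add_mem (add_mem (mul_mem (mul_mem ha ha') h01)
    (mul_mem (mul_mem ha hb') h02)) (mul_mem (mul_mem ha hc') h03)) (mul_mem hbb h12))
    (mul_mem (mul_mem hb hc') h13)) (mul_mem (mul_mem hc hc') h23)

/-- Cauchy–Binet again; the coefficient of `u₁`, `u₂`, `u₃` is the full 3 × 3 tridiagonal
determinant, assumed in `hbbb`. -/
theorem det3_comb3_comb3_comb3 (ha : a ∈ S) (hb : b ∈ S) (hc : c ∈ S) (ha' : a' ∈ S)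
    (hb' : b' ∈ S) (hc' : c' ∈ S) (ha'' : a'' ∈ S) (hb'' : b'' ∈ S) (hc'' : c'' ∈ S)
    (hbb : b * b' - c * a' ∈ S) (hbb' : b' * b'' - c' * a'' ∈ S)
    (hbbb : b * b' * b'' - b * (c' * a'') - c * a' * b'' ∈ S)
    (h012 : det3 u₀ u₁ u₂ n ∈ S) (h013 : det3 u₀ u₁ u₃ n ∈ S) (h014 : det3 u₀ u₁ u₄ n ∈ S)
    (h023 : det3 u₀ u₂ u₃ n ∈ S) (h024 : det3 u₀ u₂ u₄ n ∈ S) (h034 : det3 u₀ u₃ u₄ n ∈ S)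
    (h123 : det3 u₁ u₂ u₃ n ∈ S) (h124 : det3 u₁ u₂ u₄ n ∈ S) (h134 : det3 u₁ u₃ u₄ n ∈ S)
    (h234 : det3 u₂ u₃ u₄ n ∈ S) :
    det3 (comb3 a b c u₀ u₁ u₂) (comb3 a' b' c' u₁ u₂ u₃) (comb3 a'' b'' c'' u₂ u₃ u₄) n
      ∈ S := by
  have : det3 (comb3 a b c u₀ u₁ u₂) (comb3 a' b' c' u₁ u₂ u₃) (comb3 a'' b'' c'' u₂ u₃ u₄) n
      = a * a' * a'' * det3 u₀ u₁ u₂ n + a * a' * b'' * det3 u₀ u₁ u₃ n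
        + a * a' * c'' * det3 u₀ u₁ u₄ n + a * (b' * b'' - c' * a'') * det3 u₀ u₂ u₃ n
        + a * b' * c'' * det3 u₀ u₂ u₄ n + a * c' * c'' * det3 u₀ u₃ u₄ n
        + (b * b' * b'' - b * (c' * a'') - c * a' * b'') * det3 u₁ u₂ u₃ n
        + (b * b' - c * a') * c'' * det3 u₁ u₂ u₄ n + b * c' * c'' * det3 u₁ u₃ u₄ n
        + c * c' * c'' * det3 u₂ u₃ u₄ n := by
    simp only [det3, det2, comb3]; ring
  rw [this]
  exact add_mem (add_mem (add_mem (add_mem (add_mem (add_mem (add_mem (add_mem (add_mem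
    (mul_mem (mul_mem (mul_mem ha ha') ha'') h012) (mul_mem (mul_mem (mul_mem ha ha') hb'') h013))
    (mul_mem (mul_mem (mul_mem ha ha') hc'') h014)) (mul_mem (mul_mem ha hbb') h023))
    (mul_mem (mul_mem (mul_mem ha hb') hc'') h024)) (mul_mem (mul_mem (mul_mem ha hc') hc'') h034))
    (mul_mem hbbb h123)) (mul_mem (mul_mem hbb hc'') h124))
    (mul_mem (mul_mem (mul_mem hb hc') hc'') h134)) (mul_mem (mul_mem (mul_mem hc hc') hc'') h234)

/-- `M` is the array generated from its row `0`, which is `(1, 0, 0, …)`, by a tridiagonal matrix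
with diagonal `g`, and with entries `α`, `β` next to the diagonal. -/
structure IsTridiagonalArray (M : ℕ → ℕ → R) (α g β : ℕ → R) : Prop where
  zero_zero : M 0 0 = 1
  zero_of_ne : ∀ k, k ≠ 0 → M 0 k = 0
  left_zero : α 0 = 0
  succ : ∀ n k, M (n + 1) k = α k * M n (k - 1) + g k * M n k + β k * M n (k + 1)

namespace IsTridiagonalArray

variable {M : ℕ → ℕ → R} {α g β : ℕ → R}

theorem mem (hM : IsTridiagonalArray M α g β) (hα : ∀ k, α k ∈ S) (hg : ∀ k, g k ∈ S)
    (hβ : ∀ k, β k ∈ S) (n k : ℕ) : M n k ∈ S := by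
  induction n generalizing k with
  | zero =>
    rcases eq_or_ne k 0 with rfl | hk
    · rw [hM.zero_zero]; exact one_mem S
    · rw [hM.zero_of_ne k hk]; exact zero_mem S
  | succ n ih =>
    rw [hM.succ]
    exact add_mem (add_mem (mul_mem (hα k) (ih _)) (mul_mem (hg k) (ih _)))
      (mul_mem (hβ k) (ih _))

theorem det2_succ (hM : IsTridiagonalArray M α g β) (n i j : ℕ) :
    det2 (fun m => M m i) (fun m => M m j) (n + 1)
      = det2 (comb3 (α i) (g i) (β i) (fun m => M m (i - 1)) (fun m => M m i)
          (fun m => M m (i + 1)))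
        (comb3 (α j) (g j) (β j) (fun m => M m (j - 1)) (fun m => M m j)
          (fun m => M m (j + 1))) n := by
  simp only [det2, comb3, hM.succ]

theorem det3_succ (hM : IsTridiagonalArray M α g β) (n i j k : ℕ) :
    det3 (fun m => M m i) (fun m => M m j) (fun m => M m k) (n + 1)
      = det3 (comb3 (α i) (g i) (β i) (fun m => M m (i - 1)) (fun m => M m i)
          (fun m => M m (i + 1)))
        (comb3 (α j) (g j) (β j) (fun m => M m (j - 1)) (fun m => M m j)
          (fun m => M m (j + 1)))
        (comb3 (α k) (g k) (β k) (fun m => M m (k - 1)) (fun m => M m k)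
          (fun m => M m (k + 1))) n := by
  have key : ∀ i, (fun m => M (m + 1) i) = comb3 (α i) (g i) (β i) (fun m => M m (i - 1))
      (fun m => M m i) (fun m => M m (i + 1)) := fun i => funext fun m => hM.succ m i
  rw [← key, ← key, ← key]
  rfl

/-- One step of the recurrence moves a column index by at most 1. Columns at distance at least 2
thus stay weakly ordered and bilinearity suffices; adjacent ones can cross, and `hgg` controls that.
Allowing `i = j` covers columns that meet, as well as the truncated index `0 - 1 = 0`. -/
theorem det2_mem (hM : IsTridiagonalArray M α g β) (hα : ∀ k, α k ∈ S) (hg : ∀ k, g k ∈ S)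
    (hβ : ∀ k, β k ∈ S) (hgg : ∀ k, g k * g (k + 1) - β k * α (k + 1) ∈ S)
    (n i j : ℕ) (hij : i ≤ j) : det2 (fun m => M m i) (fun m => M m j) n ∈ S := by
  induction n generalizing i j with
  | zero =>
    rcases eq_or_lt_of_le hij with rfl | hlt
    · rw [det2_self]; exact zero_mem S
    · have : det2 (fun m => M m i) (fun m => M m j) 0 = M 0 i * M 1 j := by
        simp only [det2, hM.zero_of_ne j (by omega)]; ring
      rw [this]
      exact mul_mem (hM.mem hα hg hβ _ _) (hM.mem hα hg hβ _ _)
  | succ n ih =>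
    rcases eq_or_lt_of_le hij with rfl | hlt
    · rw [det2_self]; exact zero_mem S
    rw [hM.det2_succ]
    obtain rfl | hgap : j = i + 1 ∨ i + 2 ≤ j := by omega
    · apply det2_comb3_comb3 (hα _) (hg _) (hβ _) (hα _) (hg _) (hβ _) (hgg _) <;>
        exact ih _ _ (by omega)
    · apply det2_comb3_left (hα _) (hg _) (hβ _) <;>
        apply det2_comb3_right (hα _) (hg _) (hβ _) <;> exact ih _ _ (by omega)

theorem det3_mem (hM : IsTridiagonalArray M α g β) (hα : ∀ k, α k ∈ S) (hg : ∀ k, g k ∈ S)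
    (hβ : ∀ k, β k ∈ S) (hgg : ∀ k, g k * g (k + 1) - β k * α (k + 1) ∈ S)
    (hggg : ∀ k, g k * g (k + 1) * g (k + 2) - g k * (β (k + 1) * α (k + 2))
      - β k * α (k + 1) * g (k + 2) ∈ S)
    (n i j k : ℕ) (hij : i ≤ j) (hjk : j ≤ k) :
    det3 (fun m => M m i) (fun m => M m j) (fun m => M m k) n ∈ S := by
  induction n generalizing i j k with
  | zero =>
    rcases eq_or_lt_of_le hij with rfl | hij'
    · rw [det3_self_left]; exact zero_mem S
    rcases eq_or_lt_of_le hjk with rfl | hjk'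
    · rw [det3_self_right]; exact zero_mem S
    have : det3 (fun m => M m i) (fun m => M m j) (fun m => M m k) 0
        = M 0 i * det2 (fun m => M m j) (fun m => M m k) 1 := by
      simp only [det3, hM.zero_of_ne j (by omega), hM.zero_of_ne k (by omega)]; ring
    rw [this]
    exact mul_mem (hM.mem hα hg hβ _ _) (hM.det2_mem hα hg hβ hgg _ _ _ hjk)
  | succ n ih =>
    rcases eq_or_lt_of_le hij with rfl | hij'
    · rw [det3_self_left]; exact zero_mem S
    rcases eq_or_lt_of_le hjk with rfl | hjk'
    · rw [det3_self_right]; exact zero_mem S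
    rw [hM.det3_succ]
    -- Only adjacent columns can cross, so the cases are the ways in which the three columns group
    -- into adjacent runs.
    obtain rfl | hgap : j = i + 1 ∨ i + 2 ≤ j := by omega
    · obtain rfl | hgap' : k = i + 1 + 1 ∨ i + 3 ≤ k := by omega
      · apply det3_comb3_comb3_comb3 (hα _) (hg _) (hβ _) (hα _) (hg _) (hβ _) (hα _) (hg _) (hβ _)
          (hgg _) (hgg _) (hggg _) <;> exact ih _ _ _ (by omega) (by omega)
      · apply det3_comb3_comb3_left (hα _) (hg _) (hβ _) (hα _) (hg _) (hβ _) (hgg _) <;>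
          apply det3_comb3_right (hα _) (hg _) (hβ _) <;> exact ih _ _ _ (by omega) (by omega)
    · obtain rfl | hgap' : k = j + 1 ∨ j + 2 ≤ k := by omega
      · apply det3_comb3_left (hα _) (hg _) (hβ _) <;>
          apply det3_comb3_comb3_right (hα _) (hg _) (hβ _) (hα _) (hg _) (hβ _) (hgg _) <;>
          exact ih _ _ _ (by omega) (by omega)
      · apply det3_comb3_left (hα _) (hg _) (hβ _) <;>
          apply det3_comb3_mid (hα _) (hg _) (hβ _) <;>
          apply det3_comb3_right (hα _) (hg _) (hβ _) <;> exact ih _ _ _ (by omega) (by omega)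

/-- Since α₀ = 0, shifting column 0 by one row gives g₀ times column 0 plus β₀ times column 1; a
column operation removes the first part. -/
theorem hankel_det2 (hM : IsTridiagonalArray M α g β) (n : ℕ) :
    M n 0 * M (n + 2) 0 - M (n + 1) 0 ^ 2
      = β 0 * det2 (fun m => M m 0) (fun m => M m 1) n := by
  have h₁ := hM.succ n 0
  have h₂ := hM.succ (n + 1) 0
  simp only [hM.left_zero, zero_mul, zero_add] at h₁ h₂
  simp only [det2, add_assoc, Nat.reduceAdd] at h₁ h₂ ⊢
  linear_combination M n 0 * h₂ - M (n + 1) 0 * h₁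

/-- By Desnanot–Jacobi condensation the left side is the central entry times a 3 × 3 Hankel
determinant; column operations reduce the latter to columns 0, 1, 2 of the array. -/
theorem hankel_det3 (hM : IsTridiagonalArray M α g β) (n : ℕ) :
    (M n 0 * M (n + 2) 0 - M (n + 1) 0 ^ 2) * (M (n + 2) 0 * M (n + 4) 0 - M (n + 3) 0 ^ 2)
        - (M (n + 1) 0 * M (n + 3) 0 - M (n + 2) 0 ^ 2) ^ 2
      = M (n + 2) 0 * (β 0 ^ 2 * β 1 *
          det3 (fun m => M m 0) (fun m => M m 1) (fun m => M m 2) n) := by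
  have key : ∀ m, M (m + 1) 0 = g 0 * M m 0 + β 0 * M m 1 := fun m => by
    rw [hM.succ m 0, hM.left_zero]; ring
  have key' : ∀ m, M (m + 1) 1 = α 1 * M m 0 + g 1 * M m 1 + β 1 * M m 2 := fun m => hM.succ m 1
  have h2 : ∀ m, M (m + 2) 0 = g 0 * M (m + 1) 0
      + β 0 * (α 1 * M m 0 + g 1 * M m 1 + β 1 * M m 2) := fun m => by
    rw [key (m + 1), key' m]
  -- The left side is the Hankel determinant expanded along its first row. Its second column
  -- contributes β₀ and its third β₀β₁.
  have expand : M n 0 * (M (n + 2) 0 * M (n + 4) 0 - M (n + 3) 0 ^ 2)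
      - M (n + 1) 0 * (M (n + 1) 0 * M (n + 4) 0 - M (n + 2) 0 * M (n + 3) 0)
      + M (n + 2) 0 * (M (n + 1) 0 * M (n + 3) 0 - M (n + 2) 0 ^ 2)
      = β 0 ^ 2 * β 1 * det3 (fun m => M m 0) (fun m => M m 1) (fun m => M m 2) n := by
    have e : M n 0 * (M (n + 2) 0 * M (n + 4) 0 - M (n + 3) 0 ^ 2)
      - M (n + 1) 0 * (M (n + 1) 0 * M (n + 4) 0 - M (n + 2) 0 * M (n + 3) 0)
      + M (n + 2) 0 * (M (n + 1) 0 * M (n + 3) 0 - M (n + 2) 0 ^ 2)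
      = det3 (fun m => M m 0) (fun m => M (m + 1) 0) (fun m => M (m + 2) 0) n := by
      simp only [det3, det2, add_assoc, Nat.reduceAdd]; ring
    rw [e]
    simp only [h2, key]
    simp only [det3, det2]
    ring
  rw [← expand]
  ring

end IsTridiagonalArray

end Minors

/-! ### From tridiagonal arrays to Jacobi fractions. -/

section JacobiFraction

variable {R : Type*} [CommRing R] {M : ℕ → ℕ → R} {α g β h : ℕ → R}

/-- The generating series of a column of an array. -/
noncomputable def colSeries (M : ℕ → ℕ → R) (k : ℕ) : PowerSeries R := PowerSeries.mk fun n => M n k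

theorem X_pow_dvd_of_mul_dvd {N : ℕ} {φ ψ D J : PowerSeries R} (hJ : D * J = 1)
    (hdvd : (PowerSeries.X : PowerSeries R) ^ N ∣ D * φ - ψ) :
    (PowerSeries.X : PowerSeries R) ^ N ∣ φ - J * ψ := by
  have : φ - J * ψ = J * (D * φ - ψ) := by linear_combination -φ * hJ
  rw [this]
  exact hdvd.mul_left _

namespace IsTridiagonalArray

theorem colSeries_zero (hM : IsTridiagonalArray M α g β) :
    colSeries M 0 = 1 + PowerSeries.X * (PowerSeries.C (g 0) * colSeries M 0
      + PowerSeries.C (β 0) * colSeries M 1) := by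
  ext n
  cases n with
  | zero => simp [colSeries, hM.zero_zero]
  | succ n =>
    simp [colSeries, PowerSeries.coeff_succ_X_mul, PowerSeries.coeff_one, hM.succ n 0, hM.left_zero]

theorem colSeries_succ (hM : IsTridiagonalArray M α g β) (k : ℕ) :
    colSeries M (k + 1) = PowerSeries.X * (PowerSeries.C (α (k + 1)) * colSeries M k
      + PowerSeries.C (g (k + 1)) * colSeries M (k + 1)
      + PowerSeries.C (β (k + 1)) * colSeries M (k + 2)) := by
  ext n
  cases n with
  | zero => simp [colSeries, hM.zero_of_ne]
  | succ n => simp [colSeries, PowerSeries.coeff_succ_X_mul, hM.succ n (k + 1)]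

/-- The quotient of neighbouring column series is approximated by αx times a convergent.
Substituting the approximation for the next quotient into the column equation multiplies the error
by x, so each level gains one order. -/
theorem X_pow_dvd_colSeries_succ (hM : IsTridiagonalArray M α g β)
    (hh : ∀ k, h (k + 1) = β k * α (k + 1)) (n k : ℕ) :
    (PowerSeries.X : PowerSeries R) ^ (n + 1) ∣ colSeries M (k + 1)
      - jacobiConvergent g h n (k + 1)
        * (PowerSeries.C (α (k + 1)) * PowerSeries.X * colSeries M k) := by
  induction n generalizing k with
  | zero =>
    apply X_pow_dvd_of_mul_dvd (jacobiConvergent_zero_mul g h (k + 1))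
    refine ⟨PowerSeries.C (β (k + 1)) * colSeries M (k + 2), ?_⟩
    linear_combination hM.colSeries_succ k
  | succ n ih =>
    apply X_pow_dvd_of_mul_dvd (jacobiConvergent_succ_mul g h n (k + 1))
    obtain ⟨ρ, hρ⟩ := ih (k + 1)
    refine ⟨PowerSeries.C (β (k + 1)) * ρ, ?_⟩
    rw [hh, map_mul]
    linear_combination hM.colSeries_succ k
      + PowerSeries.X * PowerSeries.C (β (k + 1)) * hρ

theorem hasJacobiFraction (hM : IsTridiagonalArray M α g β)
    (hh : ∀ k, h (k + 1) = β k * α (k + 1)) : HasJacobiFraction (colSeries M 0) g h := by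
  intro m
  filter_upwards [Filter.eventually_ge_atTop (m + 1)] with n hn
  obtain ⟨n, rfl⟩ : ∃ n', n = n' + 1 := ⟨n - 1, by omega⟩
  have hdvd : (PowerSeries.X : PowerSeries R) ^ (n + 1) ∣ colSeries M 0
      - jacobiConvergent g h (n + 1) 0 * 1 := by
    apply X_pow_dvd_of_mul_dvd (jacobiConvergent_succ_mul g h n 0)
    obtain ⟨ρ, hρ⟩ := hM.X_pow_dvd_colSeries_succ hh n 0
    refine ⟨PowerSeries.X * PowerSeries.C (β 0) * ρ, ?_⟩
    rw [hh, map_mul]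
    linear_combination hM.colSeries_zero + PowerSeries.X * PowerSeries.C (β 0) * hρ
  rw [mul_one] at hdvd
  have := PowerSeries.X_pow_dvd_iff.1 hdvd m (by omega)
  rw [map_sub, sub_eq_zero] at this
  exact this.symm

end IsTridiagonalArray

end JacobiFraction

/-! ### The Riccati equation and the array it generates. -/

/-- Differentiating the Riccati equation gives F'' = aF' + 2bFF'. This is used in F^k F'', and the
equation itself for one factor of kF^(k-1) F'². -/
theorem derivative_pow_mul_derivative_of_riccati {R : Type*} [CommRing R] {F : PowerSeries R}
    {a b : R} (hF : PowerSeries.derivative R F = 1 + PowerSeries.C a * F + PowerSeries.C b * F ^ 2)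
    (k : ℕ) :
    PowerSeries.derivative R (F ^ k * PowerSeries.derivative R F)
      = PowerSeries.C (k : R) * (F ^ (k - 1) * PowerSeries.derivative R F)
        + PowerSeries.C (((k : R) + 1) * a) * (F ^ k * PowerSeries.derivative R F)
        + PowerSeries.C (((k : R) + 2) * b) * (F ^ (k + 1) * PowerSeries.derivative R F) := by
  have hC : ∀ c : R, PowerSeries.derivative R (PowerSeries.C c) = 0 := fun c =>
    (PowerSeries.derivative R).map_algebraMap c
  have hF' := congrArg (PowerSeries.derivative R) hF
  simp only [map_add, Derivation.map_one_eq_zero, Derivation.leibniz, Derivation.leibniz_pow, hC,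
    smul_eq_mul, nsmul_eq_mul] at hF'
  rw [Derivation.leibniz, Derivation.leibniz_pow]
  simp only [smul_eq_mul, nsmul_eq_mul, map_add, map_mul, map_natCast, map_one, map_ofNat]
  cases k with
  | zero =>
    norm_num at hF' ⊢
    linear_combination hF'
  | succ k =>
    norm_num at hF' ⊢
    linear_combination F ^ (k + 1) * hF'
      + (k + 1) * F ^ k * PowerSeries.derivative R F * hF

/-- The exponential generating series of the alternating Eulerian polynomials, without its constant
term. -/
noncomputable def altEulerianSeries : PowerSeries ℝ[X] :=
  PowerSeries.mk fun n => if n = 0 then 0 else Polynomial.C ((n.factorial : ℝ)⁻¹) * altEulerian n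

theorem coeff_altEulerianSeries_succ (n : ℕ) : PowerSeries.coeff (n + 1) altEulerianSeries
    = C (((n + 1).factorial : ℝ)⁻¹) * altEulerian (n + 1) := by
  simp [altEulerianSeries]

theorem constantCoeff_altEulerianSeries : PowerSeries.constantCoeff altEulerianSeries = 0 := by
  simp [altEulerianSeries, ← PowerSeries.coeff_zero_eq_constantCoeff_apply]

theorem coeff_derivative_altEulerianSeries (n : ℕ) :
    PowerSeries.coeff n (PowerSeries.derivative ℝ[X] altEulerianSeries)
      = C ((n.factorial : ℝ)⁻¹) * altEulerian (n + 1) := by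
  rw [PowerSeries.coeff_derivative, coeff_altEulerianSeries_succ]
  have h : ((n : ℝ[X]) + 1) = C ((n : ℝ) + 1) := by simp
  have hn : (n : ℝ) + 1 ≠ 0 := by positivity
  rw [h, mul_right_comm, ← C_mul, Nat.factorial_succ]
  congr 2
  push_cast
  field_simp

/-- The Riccati equation of the alternating Eulerian polynomials. -/
theorem derivative_altEulerianSeries :
    PowerSeries.derivative ℝ[X] altEulerianSeries = 1
      + PowerSeries.C (X + 1) * altEulerianSeries
      + PowerSeries.C ((X ^ 2 + 1) * C (1 / 2 : ℝ)) * altEulerianSeries ^ 2 := by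
  ext1 n
  rw [coeff_derivative_altEulerianSeries]
  cases n with
  | zero => simp [constantCoeff_altEulerianSeries, altEulerian_one]
  | succ n =>
    rw [map_add, map_add, PowerSeries.coeff_C_mul, PowerSeries.coeff_C_mul, PowerSeries.coeff_one,
      if_neg n.succ_ne_zero, coeff_altEulerianSeries_succ,
      sq altEulerianSeries, PowerSeries.coeff_mul,
      Finset.Nat.sum_antidiagonal_eq_sum_range_succ_mk, Finset.sum_range_succ,
      Finset.sum_range_succ']
    -- The vanishing constant term kills both ends of the convolution, leaving the index range of
    -- `two_mul_altEulerian_succ`.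
    simp only [PowerSeries.coeff_zero_eq_constantCoeff_apply, constantCoeff_altEulerianSeries,
      Nat.sub_self, zero_mul, mul_zero, add_zero, zero_add]
    have hs : ∑ k ∈ Finset.range n, PowerSeries.coeff (k + 1) altEulerianSeries
        * PowerSeries.coeff (n + 1 - (k + 1)) altEulerianSeries
        = C (((n + 1).factorial : ℝ)⁻¹) * ∑ k ∈ Finset.range n, (n + 1).choose (k + 1) •
          (altEulerian (k + 1) * altEulerian (n - k)) := by
      rw [Finset.mul_sum]
      refine Finset.sum_congr rfl fun k hk => ?_
      obtain ⟨r, rfl⟩ : ∃ r, n = k + r + 1 := ⟨n - k - 1, by have := Finset.mem_range.1 hk; omega⟩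
      have e₁ : k + r + 1 + 1 - (k + 1) = r + 1 := by omega
      have e₂ : k + r + 1 - k = r + 1 := by omega
      have e₃ : ((k + r + 1 + 1).choose (k + 1) : ℝ)
          = (k + r + 1 + 1).factorial / ((k + 1).factorial * (r + 1).factorial) := by
        rw [Nat.cast_choose ℝ (by omega), e₁]
      have e₄ : (((k + r + 1 + 1).choose (k + 1) : ℕ) : ℝ[X])
          = C ((k + r + 1 + 1).factorial / ((k + 1).factorial * (r + 1).factorial) : ℝ) := by
        rw [← e₃, map_natCast]
      have e₅ : ((k + r + 1 + 1).factorial : ℝ) ≠ 0 := by positivity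
      have e₆ : (((k + 1).factorial : ℝ)⁻¹) * ((r + 1).factorial : ℝ)⁻¹
          = ((k + r + 1 + 1).factorial : ℝ)⁻¹
            * ((k + r + 1 + 1).factorial / ((k + 1).factorial * (r + 1).factorial)) := by
        field_simp
      rw [e₁, e₂, coeff_altEulerianSeries_succ, coeff_altEulerianSeries_succ, nsmul_eq_mul, e₄,
        mul_mul_mul_comm, ← C_mul, e₆, C_mul]
      ring
    rw [hs]
    have hrec := two_mul_altEulerian_succ n
    have htwo : C (1 / 2 : ℝ) * 2 = 1 := by
      rw [← C_ofNat, ← C_mul]; norm_num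
    linear_combination C (((n + 1).factorial : ℝ)⁻¹) * C (1 / 2 : ℝ) * hrec
      - C (((n + 1).factorial : ℝ)⁻¹) * (altEulerian (n + 2) - (1 + X) * altEulerian (n + 1)) * htwo

/-- The array of the coefficients of `F ^ k * F'`, for `F = altEulerianSeries`. -/
noncomputable def altEulerianArray (n k : ℕ) : ℝ[X] :=
  C (n.factorial : ℝ) * PowerSeries.coeff n
    (altEulerianSeries ^ k * PowerSeries.derivative ℝ[X] altEulerianSeries)

theorem altEulerianArray_zero_right (n : ℕ) : altEulerianArray n 0 = altEulerian (n + 1) := by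
  have hn : (n.factorial : ℝ) ≠ 0 := by positivity
  rw [altEulerianArray, pow_zero, one_mul, coeff_derivative_altEulerianSeries, ← mul_assoc, ← C_mul,
    mul_inv_cancel₀ hn, C_1, one_mul]

/-- Coefficientwise form of the formula for (F^k F')', the factor n + 1 from differentiation being
absorbed by the factorial. Row 0 is (1, 0, 0, …) because F(0) = 0 and F'(0) = 1. -/
theorem isTridiagonalArray_altEulerianArray :
    IsTridiagonalArray altEulerianArray (fun k => (k : ℝ[X])) (fun k => ((k : ℝ[X]) + 1) * (X + 1))
      (fun k => ((k : ℝ[X]) + 2) * ((X ^ 2 + 1) * C (1 / 2 : ℝ))) where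
  zero_zero := by rw [altEulerianArray_zero_right, altEulerian_one]
  zero_of_ne k hk := by
    simp [altEulerianArray, constantCoeff_altEulerianSeries, hk]
  left_zero := Nat.cast_zero
  succ n k := by
    have h := congrArg (PowerSeries.coeff n) 
      (derivative_pow_mul_derivative_of_riccati derivative_altEulerianSeries k)
    rw [PowerSeries.coeff_derivative, map_add, map_add, PowerSeries.coeff_C_mul,
      PowerSeries.coeff_C_mul, PowerSeries.coeff_C_mul] at h
    have hfac : C ((n + 1).factorial : ℝ) = C (n.factorial : ℝ) * ((n : ℝ[X]) + 1) := by
      simp [Nat.factorial_succ, mul_comm]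
    simp only [altEulerianArray]
    rw [hfac]
    linear_combination C (n.factorial : ℝ) * h

/-! ### Nonnegativity of coefficients and the conclusion. -/

/-- The polynomials with nonnegative coefficients. -/
def nonnegCoeff : Subsemiring ℝ[X] where
  carrier := {p | ∀ j, 0 ≤ p.coeff j}
  mul_mem' {p q} hp hq j := by
    rw [coeff_mul]
    exact Finset.sum_nonneg fun x _ => mul_nonneg (hp _) (hq _)
  one_mem' j := by rw [coeff_one]; split_ifs <;> norm_num
  add_mem' {p q} hp hq j := by rw [coeff_add]; exact add_nonneg (hp j) (hq j)
  zero_mem' j := by simp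

theorem X_mem_nonnegCoeff : (X : ℝ[X]) ∈ nonnegCoeff := fun j => by
  rw [coeff_X]; split_ifs <;> norm_num

theorem C_mem_nonnegCoeff {r : ℝ} (hr : 0 ≤ r) : C r ∈ nonnegCoeff := fun j => by
  rw [coeff_C]; split_ifs <;> simp [hr]

theorem proposition4p1 :
    HasJacobiFraction (PowerSeries.mk fun n : ℕ => altEulerian (n + 1))
        (fun i : ℕ => ((i : ℝ[X]) + 1) * (X + 1))
        (fun i : ℕ => (X ^ 2 + 1) * C ((i : ℝ) * ((i : ℝ) + 1) / 2)) ∧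
      IsQLogConvexOrder 2 (fun n : ℕ => altEulerian (n + 1)) := by
  have hM := isTridiagonalArray_altEulerianArray
  have hA : ∀ n, altEulerian (n + 1) = altEulerianArray n 0 :=
    fun n => (altEulerianArray_zero_right n).symm
  simp only [hA]
  have hhalf : C (1 / 2 : ℝ) * 2 = 1 := by
    rw [← C_ofNat, ← C_mul]; norm_num
  refine ⟨hM.hasJacobiFraction fun k => ?_, ?_⟩
  · have e : C (((k + 1 : ℕ) : ℝ) * (((k + 1 : ℕ) : ℝ) + 1) / 2)
        = C (1 / 2 : ℝ) * (((k : ℝ[X]) + 1) * ((k : ℝ[X]) + 2)) := by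
      have : (((k + 1 : ℕ) : ℝ) * (((k + 1 : ℕ) : ℝ) + 1) / 2)
        = 1 / 2 * (((k : ℝ) + 1) * ((k : ℝ) + 2)) := by push_cast; ring
      rw [this]
      simp only [C_mul, C_add, C_1, map_natCast, map_ofNat]
    rw [e]
    push_cast
    ring
  have hX := X_mem_nonnegCoeff
  have hc : C (1 / 2 : ℝ) ∈ nonnegCoeff := C_mem_nonnegCoeff (by norm_num)
  have hnat : ∀ k : ℕ, (k : ℝ[X]) ∈ nonnegCoeff := fun k => natCast_mem _ k
  have h1 := one_mem nonnegCoeff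
  have h2 : (2 : ℝ[X]) ∈ nonnegCoeff := ofNat_mem _ 2
  have h3 : (3 : ℝ[X]) ∈ nonnegCoeff := ofNat_mem _ 3
  have h4 : (4 : ℝ[X]) ∈ nonnegCoeff := ofNat_mem _ 4
  have hg : ∀ k : ℕ, ((k : ℝ[X]) + 1) * (X + 1) ∈ nonnegCoeff := fun k =>
    mul_mem (add_mem (hnat k) h1) (add_mem hX h1)
  have hβ : ∀ k : ℕ, ((k : ℝ[X]) + 2) * ((X ^ 2 + 1) * C (1 / 2 : ℝ)) ∈ nonnegCoeff := fun k =>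
    mul_mem (add_mem (hnat k) h2) (mul_mem (add_mem (pow_mem hX 2) h1) hc)
  -- With (k+1)(k+2) taken out, the minor is (q+1)² - (q²+1)/2 = (q²+4q+1)/2.
  have hgg : ∀ k : ℕ, ((k : ℝ[X]) + 1) * (X + 1) * ((((k + 1 : ℕ) : ℝ[X]) + 1) * (X + 1))
      - ((k : ℝ[X]) + 2) * ((X ^ 2 + 1) * C (1 / 2 : ℝ)) * ((k + 1 : ℕ) : ℝ[X])
        ∈ nonnegCoeff := fun k => by
    have : ((k : ℝ[X]) + 1) * (X + 1) * ((((k + 1 : ℕ) : ℝ[X]) + 1) * (X + 1))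
      - ((k : ℝ[X]) + 2) * ((X ^ 2 + 1) * C (1 / 2 : ℝ)) * ((k + 1 : ℕ) : ℝ[X])
      = ((k : ℝ[X]) + 1) * ((k : ℝ[X]) + 2) * (C (1 / 2 : ℝ) * (X ^ 2 + 4 * X + 1)) := by
      push_cast
      linear_combination -((k : ℝ[X]) + 1) * ((k : ℝ[X]) + 2) * (X + 1) ^ 2 * hhalf
    rw [this]
    exact mul_mem (mul_mem (add_mem (hnat k) h1) (add_mem (hnat k) h2))
      (mul_mem hc (add_mem (add_mem (pow_mem hX 2) (mul_mem h4 hX)) h1))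
  -- The two subtracted terms coincide; with (k+1)(k+2)(k+3) taken out, (q+1)³ - (q+1)(q²+1) =
  -- 2q(q+1) remains.
  have hggg : ∀ k : ℕ, ((k : ℝ[X]) + 1) * (X + 1) * ((((k + 1 : ℕ) : ℝ[X]) + 1) * (X + 1))
        * ((((k + 2 : ℕ) : ℝ[X]) + 1) * (X + 1))
      - ((k : ℝ[X]) + 1) * (X + 1) * ((((k + 1 : ℕ) : ℝ[X]) + 2) * ((X ^ 2 + 1) * C (1 / 2 : ℝ))
        * ((k + 2 : ℕ) : ℝ[X]))
      - ((k : ℝ[X]) + 2) * ((X ^ 2 + 1) * C (1 / 2 : ℝ)) * ((k + 1 : ℕ) : ℝ[X])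
        * ((((k + 2 : ℕ) : ℝ[X]) + 1) * (X + 1)) ∈ nonnegCoeff := fun k => by
    have : ((k : ℝ[X]) + 1) * (X + 1) * ((((k + 1 : ℕ) : ℝ[X]) + 1) * (X + 1))
        * ((((k + 2 : ℕ) : ℝ[X]) + 1) * (X + 1))
      - ((k : ℝ[X]) + 1) * (X + 1) * ((((k + 1 : ℕ) : ℝ[X]) + 2) * ((X ^ 2 + 1) * C (1 / 2 : ℝ))
        * ((k + 2 : ℕ) : ℝ[X]))
      - ((k : ℝ[X]) + 2) * ((X ^ 2 + 1) * C (1 / 2 : ℝ)) * ((k + 1 : ℕ) : ℝ[X])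
        * ((((k + 2 : ℕ) : ℝ[X]) + 1) * (X + 1))
      = ((k : ℝ[X]) + 1) * ((k : ℝ[X]) + 2) * ((k : ℝ[X]) + 3) * (2 * X * (X + 1)) := by
      push_cast
      linear_combination -((k : ℝ[X]) + 1) * ((k : ℝ[X]) + 2) * ((k : ℝ[X]) + 3) * (X + 1)
        * (X ^ 2 + 1) * hhalf
    rw [this]
    exact mul_mem (mul_mem (mul_mem (add_mem (hnat k) h1) (add_mem (hnat k) h2))
      (add_mem (hnat k) h3)) (mul_mem (mul_mem h2 hX) (add_mem hX h1))
  have hmem := hM.mem hnat hg hβ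
  intro m hm i
  interval_cases m
  · exact hmem i 0
  · change altEulerianArray i 0 * altEulerianArray (i + 2) 0 - altEulerianArray (i + 1) 0 ^ 2
      ∈ nonnegCoeff
    rw [hM.hankel_det2]
    exact mul_mem (hβ 0) (hM.det2_mem hnat hg hβ hgg _ _ _ zero_le_one)
  · have h := hM.hankel_det3 i
    change (altEulerianArray i 0 * altEulerianArray (i + 2) 0 - altEulerianArray (i + 1) 0 ^ 2)
        * (altEulerianArray (i + 2) 0 * altEulerianArray (i + 4) 0
          - altEulerianArray (i + 3) 0 ^ 2)
      - (altEulerianArray (i + 1) 0 * altEulerianArray (i + 3) 0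
          - altEulerianArray (i + 2) 0 ^ 2) ^ 2 ∈ nonnegCoeff
    rw [h]
    exact mul_mem (hmem _ _) (mul_mem (mul_mem (pow_mem (hβ 0) 2) (hβ 1))
      (hM.det3_mem hnat hg hβ hgg hggg _ _ _ _ zero_le_one one_le_two))
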